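/- For real $q>0$ and complex $z$ with $\mathrm{Re}(z)>0$ let $$\zeta_E(z,q)=\sum_{n=0}^\infty\frac{(-1)^n}{(n+q)^z}$$ (the sum being the limit of the partial sums) be the alternating Hurwitz zeta function, and let the modified Stieltjes constants $\tilde\gamma_\ell(q)$, $\ell=0,1,2,\ldots$, be defined by its Taylor expansion at $z=1$, $$\zeta_E(z,q)=\sum_{\ell=0}^\infty\frac{(-1)^\ell\tilde\gamma_\ell(q)}{\ell!}(z-1)^\ell .$$ Let $E_n(x)$ be the Euler polynomials, $\frac{2e^{xt}}{e^t+1}=\sum_{n\ge0}E_n(x)\frac{t^n}{n!}$, and let $s(n,k)$ be the (signed) Stirling numbers of the first kind, $x(x-1)\cdots(x-n+1)=\sum_k s(n,k)x^k$. Theorem. For every integer $\ell\ge0$, as $q\to\infty$ through the positive reals, $\tilde\gamma_\ell(q)$ has the asymptotic expansion $$\tilde\gamma_\ell(q)\sim\frac{\log^\ell q}{2q}-\frac{\ell\log^{\ell-1}q-\log^\ell q}{4q^2}+\sum_{k=1}^\infty\frac{E_{2k+1}(0)}{2q^{2k+2}(2k+1)!}\sum_{j=0}^\ell\binom{\ell}{j}\,j!\,s(2k+2,j+1)\log^{\ell-j}q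 ,$$ where $\ell\log^{\ell-1}q$ is read as $0$ for $\ell=0$. That is: if $t_0(q)$ and $t_1(q)$ are the first two terms on the right, and $t_{k+1}(q)$ for $k\ge1$ is the term of index $k$ of the sum over $k$, then for every $n\ge0$, as $q\to\infty$, $$t_{n+1}(q)=o(t_n(q))\quad\text{and}\quad\tilde\gamma_\ell(q)-\sum_{k=0}^{n}t_k(q)=o(t_n(q)).$$ -/

import Mathlib

open Filter Asymptotics Polynomial

/-- The Euler polynomials, by the recursion `2 E_n(x) + ∑_{k < n} C(n, k) E_k(x) = 2 x ^ n`, which is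
the comparison of coefficients in `(e ^ t + 1) ∑ E_n(x) t ^ n / n! = 2 e ^ (x t)`; see
`eulerPoly_generating_function`. -/
noncomputable def eulerPoly (n : ℕ) : ℚ[X] :=
  X ^ n - C (1 / 2) * ∑ k : Fin n, C (n.choose k : ℚ) * eulerPoly k
decreasing_by exact k.2

theorem eulerPoly_sum (n : ℕ) :
    eulerPoly n + ∑ k ∈ Finset.range (n + 1), C (n.choose k : ℚ) * eulerPoly k = 2 * X ^ n := by
  have h : eulerPoly n =
      X ^ n - C (1 / 2) * ∑ k ∈ Finset.range n, C (n.choose k : ℚ) * eulerPoly k := by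
    rw [Finset.sum_range, eulerPoly]
  have h2 : (2 : ℚ[X]) * C (1 / 2) = 1 := by
    rw [show (2 : ℚ[X]) = C 2 from rfl, ← C_mul]; norm_num
  rw [Finset.sum_range_succ]
  simp only [Nat.choose_self, Nat.cast_one, map_one, one_mul]
  linear_combination (2 : ℚ[X]) * h -
    h2 * ∑ k ∈ Finset.range n, C (n.choose k : ℚ) * eulerPoly k

/-- `∑ E_n(x) t ^ n / n! * (e ^ t + 1) = 2 e ^ (x t)`, as formal power series in `t`. -/
theorem eulerPoly_generating_function (x : ℚ) :
    PowerSeries.mk (fun n => (eulerPoly n).eval x / n.factorial) * (PowerSeries.exp ℚ + 1) =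
      2 * PowerSeries.rescale x (PowerSeries.exp ℚ) := by
  ext n
  have h := congrArg (Polynomial.eval x) (eulerPoly_sum n)
  simp only [eval_add, eval_finsetSum, eval_mul, eval_C, eval_pow, eval_X, eval_ofNat] at h
  have hn : (n.factorial : ℚ) ≠ 0 := by positivity
  rw [mul_add, mul_one, map_add, PowerSeries.coeff_mul, Finset.Nat.sum_antidiagonal_eq_sum_range_succ
    (fun i j => (PowerSeries.coeff i) (PowerSeries.mk (fun n => (eulerPoly n).eval x / n.factorial)) *
      (PowerSeries.coeff j) (PowerSeries.exp ℚ)),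
    show (2 : PowerSeries ℚ) = PowerSeries.C (2 : ℚ) from rfl, PowerSeries.coeff_C_mul]
  simp only [PowerSeries.coeff_mk, PowerSeries.coeff_exp, PowerSeries.coeff_rescale,
    Algebra.algebraMap_self, RingHom.id_apply]
  rw [show (2 : ℚ) * (x ^ n * (1 / n.factorial)) = (2 * x ^ n) / n.factorial by ring, ← h, add_div,
    add_comm, Finset.sum_div]
  congr 1
  refine Finset.sum_congr rfl fun k hk => ?_
  have hk' : k ≤ n := Nat.lt_succ_iff.mp (Finset.mem_range.mp hk)
  rw [Nat.cast_choose ℚ hk']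
  field_simp

/-- The (signed) Stirling numbers of the first kind:
`x (x - 1) ⋯ (x - n + 1) = ∑ k, s(n, k) x ^ k`. -/
noncomputable def stirlingS (n k : ℕ) : ℤ := (descPochhammer ℤ n).coeff k

/-- The alternating Hurwitz zeta function `ζ_E(z, q) = ∑ (-1) ^ n / (n + q) ^ z` for `q > 0` and
`0 < re z`. For `re z ≤ 1` the series converges only conditionally, so its sum is the limit of the
partial sums. -/
noncomputable def altHurwitzZeta (q : ℝ) (z : ℂ) : ℂ :=
  limUnder atTop (fun N : ℕ => ∑ n ∈ Finset.range N, (-1 : ℂ) ^ n / ((n + q : ℝ) : ℂ) ^ z)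

/-- The modified Stieltjes constants: `(-1) ^ ℓ γ̃_ℓ(q) / ℓ!` is the coefficient of `(z - 1) ^ ℓ` in
the Taylor expansion of `ζ_E(z, q)` at `z = 1`, a point inside the half plane `0 < re z`. -/
noncomputable def modifiedStieltjes (ℓ : ℕ) (q : ℝ) : ℂ :=
  (-1) ^ ℓ * iteratedDeriv ℓ (altHurwitzZeta q) 1

/-- `f ~ ∑ t n` along the filter `l`, in the sense of Poincaré: every term is negligible against the
one before it, and the error of every partial sum is negligible against its last term. -/
def HasAsymptoticExpansion {α : Type*} (l : Filter α) (f : α → ℂ) (t : ℕ → α → ℂ) : Prop :=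
  (∀ n, t (n + 1) =o[l] t n) ∧
    ∀ n, (fun x => f x - ∑ k ∈ Finset.range (n + 1), t k x) =o[l] t n

/-- The term of index `k` in the sum over `k ≥ 1` of the expansion. -/
noncomputable def stieltjesSumTerm (ℓ k : ℕ) (q : ℝ) : ℝ :=
  (((eulerPoly (2 * k + 1)).eval 0 : ℚ) : ℝ) / (2 * q ^ (2 * k + 2) * (2 * k + 1).factorial) *
    ∑ j ∈ Finset.range (ℓ + 1),
      (ℓ.choose j : ℝ) * j.factorial * stirlingS (2 * k + 2) (j + 1) * Real.log q ^ (ℓ - j)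

/-- The successive terms of the expansion. For `ℓ = 0` the product `ℓ * log ^ (ℓ - 1) q` is `0`. -/
noncomputable def stieltjesTerm (ℓ : ℕ) : ℕ → ℝ → ℝ
  | 0, q => Real.log q ^ ℓ / (2 * q)
  | 1, q => -((ℓ * Real.log q ^ (ℓ - 1) - Real.log q ^ ℓ) / (4 * q ^ 2))
  | k + 2, q => stieltjesSumTerm ℓ (k + 1) q

/-!
The function `F(q) = ζ_E(z, q)` solves `F(q) + F(q + 1) = q ^ (-z)`. With `D = d/dq` this reads
`(1 + e ^ D) F = q ^ (-z)`, and expanding `1 / (1 + e ^ D) = ∑ E_k(0) / (2 k!) D ^ k` gives the formal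
solution `∑ E_k(0) / (2 k!) D ^ k q ^ (-z)` (Boole summation). Its truncation at `D ^ N`, `booleSum`,
satisfies the equation up to a defect made of Taylor remainders, which is `O(q ^ (-N - 1))` uniformly
for `z` in the disc of radius `1 / 2` about `1` (`exists_norm_booleDefect_le`). Telescoping the partial
sums of the series shows that they converge, and that `ζ_E(z, q)` differs from the Boole sum by the
alternating sum of the defects at `q, q + 1, …` (`altHurwitzZeta_eq`). This error is holomorphic
in `z` and `O(q ^ (1 - N))`, so by Cauchy's estimate its `ℓ`-th derivative at `z = 1` is of
the same order (`isBigO_iteratedDeriv_booleTail`). No logarithms have to be followed through the error.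

The `ℓ`-th derivative of the Boole sum at `z = 1` is computed by Leibniz' rule: with `w = 1 - z` the
function `D ^ k q ^ (-z)` is `q ^ (-k - 1) e ^ (w log q)` times `(w - 1) ⋯ (w - k)`, whose coefficients
are the Stirling numbers `s(k + 1, j + 1)` (`iteratedDeriv_powDeriv`). The `k`-th derivative so found has
exact order `log ^ ℓ q / q ^ (k + 1)` because `s(k + 1, 1) = (-1) ^ k k!` is not zero
(`isTheta_logPowDeriv`).

That every term of the expansion is negligible against the one before it also requires
`E_{2 k + 1}(0) ≠ 0`. This, and `E_{2 k}(0) = 0` for `k ≥ 1`, follow from the Riccati equation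
`y' = y ^ 2 - y` of `y = 1 / (e ^ t + 1)`, whose recursion makes the odd coefficients alternate in sign
(`booleCoeff_parity`).
-/

/-! ### The coefficients of the Boole summation formula -/

/-- The coefficient `E_k(0) / (2 k!)` of `t ^ k` in `1 / (e ^ t + 1)`. -/
noncomputable def booleCoeff (k : ℕ) : ℚ := (eulerPoly k).eval 0 / (2 * k.factorial)

theorem mk_booleCoeff_mul :
    PowerSeries.mk booleCoeff * (PowerSeries.exp ℚ + 1) = 1 := by
  have h := eulerPoly_generating_function 0
  have h1 : PowerSeries.rescale (0 : ℚ) (PowerSeries.exp ℚ) = 1 := by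
    simp
  have h2 : PowerSeries.mk (fun n => (eulerPoly n).eval 0 / (n.factorial : ℚ)) =
      2 * PowerSeries.mk booleCoeff := by
    ext n
    rw [show (2 : PowerSeries ℚ) = PowerSeries.C (2 : ℚ) from rfl, PowerSeries.coeff_C_mul]
    simp only [PowerSeries.coeff_mk, booleCoeff]
    field_simp
  rw [h1, h2, mul_assoc] at h
  have h3 : (2 : PowerSeries ℚ) ≠ 0 := by
    rw [show (2 : PowerSeries ℚ) = PowerSeries.C (2 : ℚ) from rfl]
    simp
  exact mul_left_cancel₀ h3 (by rw [h])

theorem booleCoeff_add_sum (m : ℕ) :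
    booleCoeff m + ∑ k ∈ Finset.range (m + 1), booleCoeff k / ((m - k).factorial : ℚ) =
      if m = 0 then 1 else 0 := by
  have h := congrArg (PowerSeries.coeff m) mk_booleCoeff_mul
  rw [mul_add, mul_one, map_add, PowerSeries.coeff_mul,
    Finset.Nat.sum_antidiagonal_eq_sum_range_succ
      (fun i j => (PowerSeries.coeff i) (PowerSeries.mk booleCoeff) *
        (PowerSeries.coeff j) (PowerSeries.exp ℚ)), PowerSeries.coeff_one] at h
  simp only [PowerSeries.coeff_mk, PowerSeries.coeff_exp, Algebra.algebraMap_self,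
    RingHom.id_apply] at h
  rw [← h, add_comm]
  congr 1
  exact Finset.sum_congr rfl fun k _ => by ring

theorem booleCoeff_zero : booleCoeff 0 = 1 / 2 := by
  have := booleCoeff_add_sum 0
  simp at this
  linarith

theorem booleCoeff_one : booleCoeff 1 = -1 / 4 := by
  have := booleCoeff_add_sum 1
  simp [Finset.sum_range_succ, booleCoeff_zero] at this
  linarith

/-- The Riccati equation `y' = y ^ 2 - y` for `y = 1 / (e ^ t + 1)`. -/
theorem derivative_mk_booleCoeff :
    PowerSeries.derivative ℚ (PowerSeries.mk booleCoeff) =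
      PowerSeries.mk booleCoeff ^ 2 - PowerSeries.mk booleCoeff := by
  have h := mk_booleCoeff_mul
  set y := PowerSeries.mk booleCoeff
  have hd := congrArg (PowerSeries.derivative ℚ) h
  rw [Derivation.leibniz] at hd
  simp only [map_add, PowerSeries.derivative_exp, Derivation.map_one_eq_zero, smul_eq_mul,
    add_zero] at hd
  linear_combination y * hd - (PowerSeries.derivative ℚ y) * h - y * h

/-- As the constant term is `1 / 2`, the extreme terms of the square cancel the linear term of the
Riccati equation, and only products of coefficients of positive index are left. -/
theorem booleCoeff_add_two (m : ℕ) :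
    ((m : ℚ) + 2) * booleCoeff (m + 2) =
      ∑ i ∈ Finset.range m, booleCoeff (i + 1) * booleCoeff (m - i) := by
  have h := congrArg (PowerSeries.coeff (m + 1)) derivative_mk_booleCoeff
  rw [PowerSeries.coeff_derivative, map_sub, pow_two, PowerSeries.coeff_mul,
    Finset.Nat.sum_antidiagonal_eq_sum_range_succ
      (fun i j => (PowerSeries.coeff i) (PowerSeries.mk booleCoeff) *
        (PowerSeries.coeff j) (PowerSeries.mk booleCoeff)), Finset.sum_range_succ,
    Finset.sum_range_succ'] at h
  simp only [PowerSeries.coeff_mk, Nat.add_sub_add_right, Nat.sub_self, Nat.sub_zero,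
    booleCoeff_zero] at h
  push_cast at h
  linarith

/-- The even coefficients beyond the constant one vanish, and the odd ones alternate in sign. -/
theorem booleCoeff_parity (n : ℕ) :
    (Even n → n ≠ 0 → booleCoeff n = 0) ∧
      (Odd n → 0 < (-1 : ℚ) ^ ((n + 1) / 2) * booleCoeff n) := by
  induction n using Nat.strong_induction_on with
  | _ n ih =>
    match n, ih with
    | 0, _ => simp
    | 1, _ => norm_num [booleCoeff_one]
    | m + 2, ih =>
      have hrec := booleCoeff_add_two m
      have hm : (0 : ℚ) < (m : ℚ) + 2 := by positivity
      refine ⟨fun he _ => ?_, fun ho => ?_⟩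
      · rw [Finset.sum_eq_zero] at hrec
        · exact (mul_eq_zero.mp hrec).resolve_left hm.ne'
        · intro i hi
          have hi := Finset.mem_range.mp hi
          rcases Nat.even_or_odd (i + 1) with h | h
          · rw [(ih (i + 1) (by omega)).1 h (by omega), zero_mul]
          · rw [(ih (m - i) (by omega)).1 (by grind) (by omega), mul_zero]
      · have hpos : 0 < (-1 : ℚ) ^ ((m + 2 + 1) / 2) * (((m : ℚ) + 2) * booleCoeff (m + 2)) := by
          rw [hrec, Finset.mul_sum]
          have key : ∀ i ∈ Finset.range m, Odd (i + 1) → 0 < (-1 : ℚ) ^ ((m + 2 + 1) / 2) *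
              (booleCoeff (i + 1) * booleCoeff (m - i)) := by
            intro i hi h
            have hi := Finset.mem_range.mp hi
            have h1 := (ih (i + 1) (by omega)).2 h
            have h2 := (ih (m - i) (by omega)).2 (by grind)
            have e : (m + 2 + 1) / 2 = (i + 1 + 1) / 2 + (m - i + 1) / 2 := by grind
            rw [e, pow_add]
            have := mul_pos h1 h2
            linarith
          have hm0 : m ≠ 0 ∧ 0 < m := by grind
          refine Finset.sum_pos' (fun i hi => ?_)
            ⟨0, Finset.mem_range.mpr hm0.2, key 0 (Finset.mem_range.mpr hm0.2) (by simp)⟩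
          rcases Nat.even_or_odd (i + 1) with h | h
          · rw [(ih (i + 1) (by have := Finset.mem_range.mp hi; omega)).1 h (by omega)]; simp
          · exact (key i hi h).le
        rw [mul_left_comm] at hpos
        exact pos_of_mul_pos_right hpos hm.le

/-! ### A Taylor estimate -/

/-- Taylor's estimate on an interval of length one, for a function given with all its derivatives
`g k, g (k + 1), …`. -/
theorem norm_sub_taylor_le {g : ℕ → ℝ → ℂ} {a C : ℝ}
    (hg : ∀ k, ∀ x ∈ Set.Icc a (a + 1), HasDerivAt (g k) (g (k + 1) x) x) (n : ℕ) :
    ∀ k, (∀ x ∈ Set.Icc a (a + 1), ‖g (k + n) x‖ ≤ C) → ∀ h ∈ Set.Icc (0 : ℝ) 1,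
      ‖g k (a + h) - ∑ j ∈ Finset.range n, (h : ℂ) ^ j / j.factorial * g (k + j) a‖ ≤ C := by
  induction n with
  | zero =>
    intro k hC h hh
    simpa using hC (a + h) ⟨by linarith [hh.1], by linarith [hh.2]⟩
  | succ n ih =>
    intro k hC h hh
    have hC0 : 0 ≤ C := (norm_nonneg _).trans (hC a ⟨le_rfl, by linarith⟩)
    set φ : ℝ → ℂ := fun h =>
      g k (a + h) - ∑ j ∈ Finset.range (n + 1), (h : ℂ) ^ j / j.factorial * g (k + j) a with hφ
    have hderiv : ∀ y ∈ Set.Icc (0 : ℝ) 1, HasDerivAt φ (g (k + 1) (a + y) -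
        ∑ j ∈ Finset.range n, (y : ℂ) ^ j / j.factorial * g (k + 1 + j) a) y := by
      intro y hy
      have h1 : HasDerivAt (fun h => g k (a + h)) (g (k + 1) (a + y)) y :=
        HasDerivAt.comp_const_add a y (hg k (a + y) ⟨by linarith [hy.1], by linarith [hy.2]⟩)
      have h2 : HasDerivAt (fun h : ℝ => ∑ j ∈ Finset.range (n + 1),
          (h : ℂ) ^ j / j.factorial * g (k + j) a)
          (∑ j ∈ Finset.range (n + 1), (j * (y : ℂ) ^ (j - 1)) / j.factorial * g (k + j) a) y := by
        refine HasDerivAt.fun_sum fun j _ => HasDerivAt.mul_const (HasDerivAt.div_const ?_ _) _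
        simpa using (hasDerivAt_id (y : ℂ)).pow j |>.comp_ofReal
      refine (h1.sub h2).congr_deriv ?_
      congr 1
      rw [Finset.sum_range_succ']
      simp only [Nat.cast_zero, zero_mul, zero_div, add_zero, Nat.add_sub_cancel]
      refine Finset.sum_congr rfl fun j _ => ?_
      rw [Nat.factorial_succ, show k + 1 + j = k + (j + 1) by ring]
      have : (j.factorial : ℂ) ≠ 0 := by exact_mod_cast j.factorial_ne_zero
      have : ((j : ℂ) + 1) ≠ 0 := by exact_mod_cast j.succ_ne_zero
      push_cast
      field_simp
    -- `φ` vanishes at `0`, and its derivative is the same remainder with `g (k + 1)` and `n`.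
    have h0 : φ 0 = 0 := by
      simp [hφ, Finset.sum_range_succ']
    have := (convex_Icc (0 : ℝ) 1).norm_image_sub_le_of_norm_hasDerivWithin_le
      (fun y hy => (hderiv y hy).hasDerivWithinAt)
      (fun y hy => ih (k + 1) (by rwa [add_right_comm]) y hy) ⟨le_rfl, zero_le_one⟩ hh
    rw [h0, sub_zero, sub_zero, Real.norm_of_nonneg hh.1] at this
    exact this.trans (mul_le_of_le_one_right hC0 hh.2)

/-! ### Boole sums of powers and their defect -/

/-- The `k`-th derivative of `x ↦ x ^ (-z)` on the positive reals, in closed form. -/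
noncomputable def powDeriv (z : ℂ) (k : ℕ) (x : ℝ) : ℂ :=
  (descPochhammer ℂ k).eval (-z) * (x : ℂ) ^ (-z - k)

theorem hasDerivAt_powDeriv {z : ℂ} (hz : 0 < z.re) (k : ℕ) {x : ℝ} (hx : 0 < x) :
    HasDerivAt (powDeriv z k) (powDeriv z (k + 1) x) x := by
  have hr : -z - k ≠ 0 := by
    intro h
    have := congrArg Complex.re h
    simp at this
    have : (0 : ℝ) ≤ k := k.cast_nonneg
    linarith
  refine ((hasDerivAt_ofReal_cpow_const hx.ne' hr).const_mul
    ((descPochhammer ℂ k).eval (-z))).congr_deriv ?_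
  rw [powDeriv, descPochhammer_succ_eval, mul_assoc]
  congr 3
  push_cast
  ring

theorem half_lt_re {z : ℂ} (hz : z ∈ Metric.ball (1 : ℂ) (1 / 2)) : 1 / 2 < z.re := by
  have h := (Complex.abs_re_le_norm (z - 1)).trans_lt (mem_ball_iff_norm.mp hz)
  rw [Complex.sub_re, Complex.one_re] at h
  linarith [(abs_lt.mp h).1]

theorem norm_descPochhammer_eval_neg_le {z : ℂ} (hz : z ∈ Metric.ball (1 : ℂ) (1 / 2)) (k : ℕ) :
    ‖(descPochhammer ℂ k).eval (-z)‖ ≤ (k + 1).factorial := by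
  induction k with
  | zero => simp
  | succ k ih =>
    rw [descPochhammer_succ_eval, norm_mul, Nat.factorial_succ, mul_comm]
    push_cast
    gcongr
    have h1 : ‖z - 1‖ < 1 / 2 := mem_ball_iff_norm.mp hz
    calc ‖-z - k‖ = ‖(z - 1) + ((k + 1 : ℕ) : ℂ)‖ := by
          rw [← norm_neg]; congr 1; push_cast; ring
      _ ≤ ‖z - 1‖ + ‖((k + 1 : ℕ) : ℂ)‖ := norm_add_le _ _
      _ ≤ _ := by rw [Complex.norm_natCast]; push_cast; linarith

theorem norm_powDeriv_le {z : ℂ} (hz : z ∈ Metric.ball (1 : ℂ) (1 / 2)) (k : ℕ) {x : ℝ}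
    (hx : 1 ≤ x) : ‖powDeriv z k x‖ ≤ (k + 1).factorial * x ^ (-(1 / 2 : ℝ) - k) := by
  rw [powDeriv, norm_mul, Complex.norm_cpow_eq_rpow_re_of_pos (by linarith)]
  have := half_lt_re hz
  gcongr
  · exact norm_descPochhammer_eval_neg_le hz k
  · simp
    linarith

theorem differentiable_powDeriv (k : ℕ) {x : ℝ} (hx : 0 < x) :
    Differentiable ℂ fun z => powDeriv z k x := by
  have hx' : (x : ℂ) ≠ 0 := by exact_mod_cast hx.ne'
  unfold powDeriv
  refine Differentiable.mul ?_ ?_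
  · exact (descPochhammer ℂ k).differentiable.comp differentiable_neg
  · exact Differentiable.const_cpow (by fun_prop) (Or.inl hx')

/-- The Boole sum of order `N` for `∑ (-1) ^ n (x + n) ^ (-z)`: the truncation after the power
`D ^ N` of the operator `1 / (1 + e ^ D)`, where `D = d/dx`, applied to `x ^ (-z)`. -/
noncomputable def booleSum (N : ℕ) (z : ℂ) (x : ℝ) : ℂ :=
  ∑ k ∈ Finset.range (N + 1), (booleCoeff k : ℂ) * powDeriv z k x

/-- The defect of the Boole sum in the equation `F(x) + F(x + 1) = x ^ (-z)`. -/
noncomputable def booleDefect (N : ℕ) (z : ℂ) (x : ℝ) : ℂ :=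
  booleSum N z x + booleSum N z (x + 1) - (x : ℂ) ^ (-z)

theorem differentiable_booleSum (N : ℕ) {x : ℝ} (hx : 0 < x) :
    Differentiable ℂ fun z => booleSum N z x :=
  Differentiable.fun_sum fun k _ => (differentiable_powDeriv k hx).const_mul _

theorem differentiable_booleDefect (N : ℕ) {x : ℝ} (hx : 0 < x) :
    Differentiable ℂ fun z => booleDefect N z x := by
  have hx' : (x : ℂ) ≠ 0 := by exact_mod_cast hx.ne'
  exact ((differentiable_booleSum N hx).add (differentiable_booleSum N (by linarith))).sub
    (Differentiable.const_cpow (by fun_prop) (Or.inl hx'))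

/-- The defect is a combination of Taylor remainders: the Taylor polynomials themselves cancel by
the recursion of the coefficients. -/
theorem booleDefect_eq (N : ℕ) (z : ℂ) (x : ℝ) :
    booleDefect N z x = ∑ k ∈ Finset.range (N + 1), (booleCoeff k : ℂ) *
      (powDeriv z k (x + 1) -
        ∑ j ∈ Finset.range (N + 1 - k), (1 : ℂ) ^ j / j.factorial * powDeriv z (k + j) x) := by
  have h1 : ∑ k ∈ Finset.range (N + 1), (booleCoeff k : ℂ) *
      ∑ j ∈ Finset.range (N + 1 - k), (1 : ℂ) ^ j / j.factorial * powDeriv z (k + j) x =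
      ∑ m ∈ Finset.range (N + 1), (∑ k ∈ Finset.range (m + 1),
        (booleCoeff k : ℂ) / (m - k).factorial) * powDeriv z m x := by
    simp_rw [Finset.mul_sum, Finset.sum_mul]
    symm
    rw [Finset.sum_comm' (t' := Finset.range (N + 1)) (s' := fun k => Finset.Ico k (N + 1))]
    · refine Finset.sum_congr rfl fun k _ => ?_
      rw [Finset.sum_Ico_eq_sum_range]
      refine Finset.sum_congr rfl fun j _ => ?_
      rw [Nat.add_sub_cancel_left, one_pow]
      ring
    · intro m k
      simp only [Finset.mem_range, Finset.mem_Ico]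
      omega
  have h2 : ∀ m, (booleCoeff m : ℂ) + ∑ k ∈ Finset.range (m + 1),
      (booleCoeff k : ℂ) / (m - k).factorial = if m = 0 then 1 else 0 := by
    intro m
    have h := congrArg (fun c : ℚ => (c : ℂ)) (booleCoeff_add_sum m)
    push_cast at h
    split_ifs at h ⊢ <;> simpa using h
  simp_rw [mul_sub]
  rw [Finset.sum_sub_distrib, h1, booleDefect, booleSum, booleSum]
  have h3 : ∑ m ∈ Finset.range (N + 1), ((booleCoeff m : ℂ) + ∑ k ∈ Finset.range (m + 1),
      (booleCoeff k : ℂ) / (m - k).factorial) * powDeriv z m x = (x : ℂ) ^ (-z) := by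
    simp_rw [h2]
    simp [powDeriv]
  simp_rw [add_mul] at h3
  rw [Finset.sum_add_distrib] at h3
  linear_combination h3

theorem exists_norm_booleDefect_le (N : ℕ) : ∃ K : ℝ, ∀ z ∈ Metric.ball (1 : ℂ) (1 / 2),
    ∀ x : ℝ, 1 ≤ x → ‖booleDefect N z x‖ ≤ K / x ^ (N + 1) := by
  refine ⟨(∑ k ∈ Finset.range (N + 1), ‖(booleCoeff k : ℂ)‖) * (N + 2).factorial,
    fun z hz x hx => ?_⟩
  have hx0 : 0 < x := by linarith
  rw [booleDefect_eq, Finset.sum_mul, Finset.sum_div]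
  refine (norm_sum_le _ _).trans (Finset.sum_le_sum fun k hk => ?_)
  rw [norm_mul, mul_div_assoc]
  gcongr
  have hk := Finset.mem_range.mp hk
  have := norm_sub_taylor_le (g := powDeriv z) (a := x) (C := (N + 2).factorial / x ^ (N + 1))
    (fun k y hy => hasDerivAt_powDeriv (by linarith [half_lt_re hz]) k (by linarith [hy.1]))
    (N + 1 - k) k (fun y hy => ?_) 1 ⟨zero_le_one, le_rfl⟩
  · simpa using this
  · rw [Nat.add_sub_of_le hk.le]
    have hy0 : 0 < y := by linarith [hy.1]
    refine (norm_powDeriv_le hz (N + 1) (by linarith [hy.1])).trans ?_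
    rw [div_eq_mul_inv]
    refine mul_le_mul_of_nonneg_left ?_ (by positivity)
    calc y ^ (-(1 / 2 : ℝ) - (N + 1 : ℕ)) ≤ y ^ (-((N + 1 : ℕ) : ℝ)) :=
          Real.rpow_le_rpow_of_exponent_le (by linarith [hy.1]) (by linarith)
      _ = (y ^ (N + 1))⁻¹ := by rw [Real.rpow_neg hy0.le, Real.rpow_natCast]
      _ ≤ _ := by gcongr; exact hy.1

/-! ### Boole summation of the alternating Hurwitz zeta function -/

theorem tendsto_booleSum_atTop (N : ℕ) {z : ℂ} (hz : z ∈ Metric.ball (1 : ℂ) (1 / 2)) :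
    Tendsto (booleSum N z) atTop (nhds 0) := by
  rw [← Finset.sum_const_zero (s := Finset.range (N + 1))]
  refine tendsto_finsetSum _ fun k _ => ?_
  rw [← mul_zero (booleCoeff k : ℂ)]
  refine Tendsto.const_mul _ ?_
  have h : Tendsto (fun x : ℝ => (k + 1).factorial * x ^ (-(1 / 2 + k : ℝ))) atTop (nhds 0) := by
    rw [← mul_zero ((k + 1).factorial : ℝ)]
    exact (tendsto_rpow_neg_atTop (by positivity)).const_mul _
  refine squeeze_zero_norm' ?_ h
  filter_upwards [eventually_ge_atTop 1] with x hx
  refine (norm_powDeriv_le hz k hx).trans_eq ?_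
  congr 2
  ring

/-- The equation `F(x) + F(x + 1) = x ^ (-z) + defect` for the Boole sum, telescoped. -/
theorem sum_range_neg_one_pow_div_cpow (N : ℕ) (z : ℂ) (q : ℝ) (M : ℕ) :
    ∑ n ∈ Finset.range M, (-1 : ℂ) ^ n / ((n + q : ℝ) : ℂ) ^ z =
      booleSum N z q - (-1) ^ M * booleSum N z (M + q) -
        ∑ n ∈ Finset.range M, (-1 : ℂ) ^ n * booleDefect N z (n + q) := by
  induction M with
  | zero => simp
  | succ M ih =>
    rw [Finset.sum_range_succ, Finset.sum_range_succ, ih, booleDefect, Complex.cpow_neg,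
      show ((M + 1 : ℕ) : ℝ) + q = M + q + 1 by push_cast; ring]
    ring

/-- The error of the Boole sum of order `N`, up to sign: the alternating sum of the defects at
`q, q + 1, …`. -/
noncomputable def booleTail (N : ℕ) (q : ℝ) (z : ℂ) : ℂ :=
  ∑' n : ℕ, (-1 : ℂ) ^ n * booleDefect N z (n + q)

theorem summable_one_div_add_one_sq : Summable fun n : ℕ => 1 / ((n : ℝ) + 1) ^ 2 := by
  have := (summable_nat_add_iff 1).mpr (Real.summable_one_div_nat_pow.mpr one_lt_two)
  simpa using this

/-- Two of the powers of `q + n` make the series over `n` converge, the others give the decay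
in `q`. -/
theorem exists_norm_booleDefect_add_le (N : ℕ) : ∃ K : ℝ, ∀ z ∈ Metric.ball (1 : ℂ) (1 / 2),
    ∀ q : ℝ, 1 ≤ q → ∀ n : ℕ, ‖(-1 : ℂ) ^ n * booleDefect (N + 1) z (n + q)‖ ≤
      K / q ^ N * (1 / ((n : ℝ) + 1) ^ 2) := by
  obtain ⟨K, hK⟩ := exists_norm_booleDefect_le (N + 1)
  have hK0 : 0 ≤ K := by
    simpa using (norm_nonneg _).trans (hK 1 (Metric.mem_ball_self (by norm_num)) 1 le_rfl)
  refine ⟨K, fun z hz q hq n => ?_⟩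
  have hn : (0 : ℝ) ≤ n := n.cast_nonneg
  rw [norm_mul, norm_pow, norm_neg, norm_one, one_pow, one_mul, div_mul_div_comm, mul_one]
  refine (hK z hz (n + q) (by linarith)).trans ?_
  rw [show N + 1 + 1 = N + 2 by rfl, pow_add _ N 2]
  have : q ≤ n + q := by linarith
  have : (n : ℝ) + 1 ≤ n + q := by linarith
  gcongr

theorem altHurwitzZeta_eq (N : ℕ) {q : ℝ} (hq : 1 ≤ q) {z : ℂ}
    (hz : z ∈ Metric.ball (1 : ℂ) (1 / 2)) :
    altHurwitzZeta q z = booleSum (N + 1) z q - booleTail (N + 1) q z := by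
  obtain ⟨K, hK⟩ := exists_norm_booleDefect_add_le N
  refine Tendsto.limUnder_eq ?_
  simp_rw [sum_range_neg_one_pow_div_cpow (N + 1) z q]
  have hs : Summable fun n : ℕ => (-1 : ℂ) ^ n * booleDefect (N + 1) z (n + q) :=
    Summable.of_norm_bounded (summable_one_div_add_one_sq.mul_left _) (hK z hz q hq)
  have h0 : Tendsto (fun M : ℕ => (-1 : ℂ) ^ M * booleSum (N + 1) z (M + q)) atTop (nhds 0) := by
    have := ((tendsto_booleSum_atTop (N + 1) hz).comp
      (tendsto_atTop_add_const_right atTop q tendsto_natCast_atTop_atTop)).norm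
    rw [norm_zero] at this
    refine squeeze_zero_norm (fun M => ?_) this
    simp
  simpa [booleTail] using (h0.const_sub (booleSum (N + 1) z q)).sub hs.hasSum.tendsto_sum_nat

theorem differentiableOn_booleTail (N : ℕ) {q : ℝ} (hq : 1 ≤ q) :
    DifferentiableOn ℂ (booleTail (N + 1) q) (Metric.ball 1 (1 / 2)) := by
  obtain ⟨K, hK⟩ := exists_norm_booleDefect_add_le N
  refine Complex.differentiableOn_tsum_of_summable_norm
    (summable_one_div_add_one_sq.mul_left (K / q ^ N)) (fun n => ?_) Metric.isOpen_ball
    fun n z hz => hK z hz q hq n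
  have : 0 < n + q := by positivity
  exact ((differentiable_booleDefect (N + 1) this).const_mul _).differentiableOn

/-- By Cauchy's estimate the derivatives of the tail in `z` decay in `q` as fast as the tail. -/
theorem isBigO_iteratedDeriv_booleTail (N ℓ : ℕ) :
    (fun q : ℝ => iteratedDeriv ℓ (booleTail (N + 1) q) 1) =O[atTop] fun q => (q ^ N)⁻¹ := by
  obtain ⟨K, hK⟩ := exists_norm_booleDefect_add_le N
  set S := ∑' n : ℕ, 1 / ((n : ℝ) + 1) ^ 2
  refine IsBigO.of_bound (ℓ.factorial * (K * S) / (1 / 4) ^ ℓ) ?_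
  filter_upwards [eventually_ge_atTop 1] with q hq
  have hball : Metric.closedBall (1 : ℂ) (1 / 4) ⊆ Metric.ball 1 (1 / 2) :=
    Metric.closedBall_subset_ball (by norm_num)
  have h := Complex.norm_iteratedDeriv_le_of_forall_mem_sphere_norm_le (f := booleTail (N + 1) q)
    (c := 1) (R := 1 / 4) (C := K / q ^ N * S) ℓ (by norm_num)
    (((differentiableOn_booleTail N hq).mono hball).diffContOnCl_ball subset_rfl) fun z hz => ?_
  · refine h.trans_eq ?_
    rw [Real.norm_of_nonneg (by positivity)]
    ring
  · exact tsum_of_norm_bounded (summable_one_div_add_one_sq.hasSum.mul_left _)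
      fun n => hK z (hball (Metric.sphere_subset_closedBall hz)) q hq n

/-! ### Derivatives in the exponent -/

/-- The `k`-th derivative of `log ^ ℓ q / q`, in closed form. -/
noncomputable def logPowDeriv (ℓ k : ℕ) (q : ℝ) : ℝ :=
  (∑ j ∈ Finset.range (ℓ + 1),
    (ℓ.choose j : ℝ) * j.factorial * stirlingS (k + 1) (j + 1) * Real.log q ^ (ℓ - j)) / q ^ (k + 1)

theorem iteratedDeriv_eval_zero (p : ℂ[X]) (j : ℕ) :
    iteratedDeriv j (fun w => p.eval w) 0 = j.factorial * p.coeff j := by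
  have h : ∀ (j : ℕ) (p : ℂ[X]), iteratedDeriv j (fun w => p.eval w) =
      fun w => (derivative^[j] p).eval w := by
    intro j
    induction j with
    | zero => intro p; simp
    | succ j ih =>
      intro p
      rw [iteratedDeriv_succ']
      have : deriv (fun w => p.eval w) = fun w => p.derivative.eval w := by
        ext w; simp
      rw [this, ih, Function.iterate_succ_apply]
  rw [h]
  simp only [← coeff_zero_eq_eval_zero, coeff_iterate_derivative, zero_add, Nat.descFactorial_self,
    nsmul_eq_mul]

/-- With `w = 1 - z` the factor of `x ^ (-z - k)` is `(w - 1) ⋯ (w - k)`, which is the falling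
factorial of order `k + 1` divided by `w`. -/
theorem coeff_descPochhammer_comp (k j : ℕ) :
    ((descPochhammer ℂ k).comp (X - 1)).coeff j = stirlingS (k + 1) (j + 1) := by
  rw [stirlingS, ← coeff_X_mul, ← descPochhammer_succ_left, ← descPochhammer_map (Int.castRingHom ℂ),
    coeff_map, eq_intCast]

theorem iteratedDeriv_powDeriv (ℓ k : ℕ) {q : ℝ} (hq : 0 < q) :
    iteratedDeriv ℓ (fun z => powDeriv z k q) 1 = (-1) ^ ℓ * logPowDeriv ℓ k q := by
  set p := (descPochhammer ℂ k).comp (X - 1) with hp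
  set L : ℂ := (Real.log q : ℂ) with hL
  have hq' : (q : ℂ) ≠ 0 := by exact_mod_cast hq.ne'
  have h1 : (fun z => powDeriv z k q) = fun z =>
      (fun w => ((q : ℂ) ^ (k + 1))⁻¹ * (p.eval w * Complex.exp (L * w))) (1 - z) := by
    ext z
    have e : -z - k = (1 - z) - ((k + 1 : ℕ) : ℂ) := by push_cast; ring
    simp only [powDeriv, hp, eval_comp, eval_sub, eval_X, eval_one]
    rw [e, Complex.cpow_sub _ _ hq', Complex.cpow_natCast, Complex.cpow_def_of_ne_zero hq',
      ← Complex.ofReal_log hq.le, ← hL]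
    rw [show (1 - z - 1 : ℂ) = -z by ring]
    ring
  rw [h1, iteratedDeriv_comp_const_sub ℓ
    (fun w => ((q : ℂ) ^ (k + 1))⁻¹ * (p.eval w * Complex.exp (L * w))) 1]
  simp only [sub_self, smul_eq_mul]
  rw [iteratedDeriv_const_mul_field, iteratedDeriv_fun_mul
    p.differentiable.contDiff.contDiffAt (by fun_prop)]
  congr 1
  rw [logPowDeriv]
  push_cast
  rw [div_eq_inv_mul]
  congr 1
  refine Finset.sum_congr rfl fun j _ => ?_
  rw [iteratedDeriv_eval_zero, iteratedDeriv_cexp_const_mul, hp, coeff_descPochhammer_comp]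
  simp only [mul_zero, Complex.exp_zero, mul_one, hL]
  ring

/-- The Boole summation formula for the modified Stieltjes constants, with an error of arbitrarily
high order. -/
theorem isBigO_modifiedStieltjes_sub (N ℓ : ℕ) :
    (fun q : ℝ => modifiedStieltjes ℓ q -
      ((∑ k ∈ Finset.range (N + 2), (booleCoeff k : ℝ) * logPowDeriv ℓ k q : ℝ) : ℂ))
      =O[atTop] fun q => (q ^ N)⁻¹ := by
  refine ((isBigO_iteratedDeriv_booleTail N ℓ).const_mul_left (-(-1) ^ ℓ)).congr' ?_ .rfl
  filter_upwards [eventually_ge_atTop 1] with q hq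
  have hq0 : 0 < q := by linarith
  have hmem : Metric.ball (1 : ℂ) (1 / 2) ∈ nhds 1 := Metric.ball_mem_nhds _ (by norm_num)
  have heq : altHurwitzZeta q =ᶠ[nhds 1]
      ((fun z => booleSum (N + 1) z q) - booleTail (N + 1) q) := by
    filter_upwards [hmem] with z hz
    exact altHurwitzZeta_eq N hq hz
  have h1 : ContDiffAt ℂ ℓ (fun z => booleSum (N + 1) z q) 1 :=
    (differentiable_booleSum (N + 1) hq0).contDiff.contDiffAt
  have h2 : ContDiffAt ℂ ℓ (booleTail (N + 1) q) 1 :=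
    ((differentiableOn_booleTail N hq).analyticAt hmem).contDiffAt
  rw [modifiedStieltjes, heq.iteratedDeriv_eq, iteratedDeriv_sub h1 h2]
  have h3 : iteratedDeriv ℓ (fun z => booleSum (N + 1) z q) 1 = (-1) ^ ℓ *
      ((∑ k ∈ Finset.range (N + 2), (booleCoeff k : ℝ) * logPowDeriv ℓ k q : ℝ) : ℂ) := by
    simp only [booleSum]
    rw [iteratedDeriv_fun_sum fun k _ =>
      ((differentiable_powDeriv k hq0).const_mul _).contDiff.contDiffAt]
    push_cast
    rw [Finset.mul_sum]
    refine Finset.sum_congr rfl fun k _ => ?_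
    rw [iteratedDeriv_const_mul_field, iteratedDeriv_powDeriv ℓ k hq0]
    ring
  have h4 : ((-1 : ℂ) ^ ℓ) * (-1) ^ ℓ = 1 := by rw [← mul_pow]; simp
  rw [h3]
  linear_combination -((∑ k ∈ Finset.range (N + 2), (booleCoeff k : ℝ) *
    logPowDeriv ℓ k q : ℝ) : ℂ) * h4

/-! ### Orders of magnitude of the terms -/

theorem stirlingS_succ_one_ne_zero (k : ℕ) : stirlingS (k + 1) 1 ≠ 0 := by
  have h : ∀ k, (descPochhammer ℤ k).eval (-1) ≠ 0 := by
    intro k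
    induction k with
    | zero => simp
    | succ k ih =>
      rw [descPochhammer_succ_eval]
      exact mul_ne_zero ih (by omega)
  rw [stirlingS, descPochhammer_succ_left, coeff_X_mul, coeff_zero_eq_eval_zero, eval_comp]
  simpa using h k

/-- Only the summand with `log ^ ℓ q` matters to leading order, and its coefficient
`s(k + 1, 1) = (-1) ^ k k!` does not vanish. -/
theorem isTheta_logPowDeriv (ℓ k : ℕ) :
    logPowDeriv ℓ k =Θ[atTop] fun q => Real.log q ^ ℓ / q ^ (k + 1) := by
  refine IsTheta.div ?_ (isTheta_refl _ _)
  simp_rw [Finset.sum_range_succ']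
  have hs : (stirlingS (k + 1) (0 + 1) : ℝ) ≠ 0 := by exact_mod_cast stirlingS_succ_one_ne_zero k
  have hlead : (fun q => (ℓ.choose 0 : ℝ) * (Nat.factorial 0) * stirlingS (k + 1) (0 + 1) *
      Real.log q ^ (ℓ - 0)) =Θ[atTop] fun q => Real.log q ^ ℓ := by
    rw [isTheta_const_mul_left (by simpa using hs)]
    exact isTheta_refl _ _
  refine IsTheta.trans (IsLittleO.right_isTheta_add ?_).symm hlead
  refine IsLittleO.trans_isTheta (IsLittleO.fun_sum fun j hj => ?_) hlead.symm
  have hj := Finset.mem_range.mp hj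
  exact ((isLittleO_pow_pow_atTop_of_lt (by omega)).comp_tendsto
    Real.tendsto_log_atTop).const_mul_left _

theorem isLittleO_inv_pow_atTop {a b : ℕ} (h : a < b) :
    (fun q : ℝ => (q ^ b)⁻¹) =o[atTop] fun q => (q ^ a)⁻¹ := by
  refine (isLittleO_pow_pow_atTop_of_lt h).inv_rev ?_
  filter_upwards [eventually_gt_atTop 0] with q hq h0
  exact absurd h0 (pow_pos hq _).ne'

theorem isLittleO_logPowDeriv {a b : ℕ} (ℓ : ℕ) (h : a < b) :
    logPowDeriv ℓ b =o[atTop] logPowDeriv ℓ a := by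
  refine ((isTheta_logPowDeriv ℓ b).trans_isLittleO ?_).trans_isTheta (isTheta_logPowDeriv ℓ a).symm
  simp_rw [div_eq_mul_inv]
  exact (isBigO_refl _ _).mul_isLittleO (isLittleO_inv_pow_atTop (by omega))

theorem isLittleO_inv_pow_logPowDeriv {a b : ℕ} (ℓ : ℕ) (h : a + 1 < b) :
    (fun q : ℝ => (q ^ b)⁻¹) =o[atTop] logPowDeriv ℓ a := by
  refine IsLittleO.trans_isTheta ?_ (isTheta_logPowDeriv ℓ a).symm
  refine (isLittleO_inv_pow_atTop h).trans_isBigO (IsBigO.of_bound 1 ?_)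
  filter_upwards [Real.tendsto_log_atTop.eventually_ge_atTop 1] with q hq
  rw [div_eq_mul_inv, norm_mul, one_mul, norm_pow, Real.norm_of_nonneg (by linarith : 0 ≤ Real.log q)]
  exact le_mul_of_one_le_left (norm_nonneg _) (one_le_pow₀ hq)

/-- The terms of the expansion are the nonzero terms of the Boole sum: their indices are
`0, 1, 3, 5, …`, that is `2 n - 1` in truncated subtraction. -/
theorem stieltjesTerm_eq (ℓ n : ℕ) (q : ℝ) :
    stieltjesTerm ℓ n q = booleCoeff (2 * n - 1) * logPowDeriv ℓ (2 * n - 1) q := by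
  match n with
  | 0 =>
    have h : ∀ j, stirlingS 1 (j + 1) = if j = 0 then 1 else 0 := fun j => by
      simp [stirlingS, coeff_X]
    simp [stieltjesTerm, logPowDeriv, h, booleCoeff_zero]
    ring
  | 1 =>
    have h : ∀ j, stirlingS 2 (j + 1) = if j = 0 then -1 else if j = 1 then 1 else 0 := fun j => by
      rw [stirlingS, descPochhammer_succ_right]
      rcases j with _ | _ | j <;> simp [coeff_X, mul_sub, ← pow_two, coeff_X_pow]
    cases ℓ with
    | zero => simp [stieltjesTerm, logPowDeriv, h, booleCoeff_one]; ring
    | succ ℓ =>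
      simp [stieltjesTerm, logPowDeriv, h, booleCoeff_one, Finset.sum_range_succ' _ (ℓ + 1),
        Finset.sum_range_succ' _ ℓ]
      ring
  | k + 2 =>
    rw [show 2 * (k + 2) - 1 = 2 * (k + 1) + 1 by omega, stieltjesTerm, stieltjesSumTerm,
      logPowDeriv, booleCoeff]
    push_cast
    ring

theorem booleCoeff_two_mul_sub_one_ne_zero (n : ℕ) : booleCoeff (2 * n - 1) ≠ 0 := by
  cases n with
  | zero => norm_num [booleCoeff_zero]
  | succ n =>
    have := ((booleCoeff_parity (2 * (n + 1) - 1)).2 ⟨n, by omega⟩).ne'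
    exact right_ne_zero_of_mul this

theorem sum_booleCoeff_mul (f : ℕ → ℝ) (M : ℕ) :
    ∑ k ∈ Finset.range (2 * M + 2), (booleCoeff k : ℝ) * f k =
      ∑ i ∈ Finset.range (M + 2), (booleCoeff (2 * i - 1) : ℝ) * f (2 * i - 1) := by
  induction M with
  | zero => simp [Finset.sum_range_succ]
  | succ M ih =>
    rw [show 2 * (M + 1) + 2 = 2 * M + 2 + 1 + 1 by ring, Finset.sum_range_succ,
      Finset.sum_range_succ, ih, Finset.sum_range_succ _ (M + 2),
      (booleCoeff_parity (2 * M + 2)).1 ⟨M + 1, by ring⟩ (by omega),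
      show 2 * (M + 2) - 1 = 2 * M + 2 + 1 by omega]
    simp

theorem isTheta_stieltjesTerm (ℓ n : ℕ) :
    (fun q => ((stieltjesTerm ℓ n q : ℝ) : ℂ)) =Θ[atTop] logPowDeriv ℓ (2 * n - 1) := by
  have h : stieltjesTerm ℓ n =Θ[atTop] logPowDeriv ℓ (2 * n - 1) := by
    rw [show stieltjesTerm ℓ n = fun q => (booleCoeff (2 * n - 1) : ℝ) *
      logPowDeriv ℓ (2 * n - 1) q from funext (stieltjesTerm_eq ℓ n), isTheta_const_mul_left
        (by exact_mod_cast booleCoeff_two_mul_sub_one_ne_zero n)]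
    exact isTheta_refl _ _
  refine IsTheta.trans (IsTheta.of_norm_eventuallyEq_norm ?_) h
  exact .of_forall fun q => Complex.norm_real _

theorem isLittleO_stieltjesTerm (ℓ : ℕ) {m n : ℕ} (h : m < n) :
    (fun q => ((stieltjesTerm ℓ n q : ℝ) : ℂ)) =o[atTop]
      fun q => ((stieltjesTerm ℓ m q : ℝ) : ℂ) :=
  ((isTheta_stieltjesTerm ℓ n).trans_isLittleO (isLittleO_logPowDeriv ℓ (by omega))).trans_isTheta
    (isTheta_stieltjesTerm ℓ m).symm

theorem theorem3p13 (ℓ : ℕ) :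
    HasAsymptoticExpansion atTop (fun q : ℝ => modifiedStieltjes ℓ q)
      (fun n q => ((stieltjesTerm ℓ n q : ℝ) : ℂ)) := by
  refine ⟨fun n => isLittleO_stieltjesTerm ℓ n.lt_succ_self, fun n => ?_⟩
  -- The sum up to the `(n + 2)`-th term has error `O (q ^ (-2 n - 2))`, which is `o` of the `n`-th
  -- term, of order `q ^ (-2 n)` up to logarithms (`q ^ (-1)` for `n = 0`); so are the two extra terms.
  have h1 := (isBigO_modifiedStieltjes_sub (2 * (n + 1)) ℓ).trans_isLittleO
    ((isLittleO_inv_pow_logPowDeriv (a := 2 * n - 1) ℓ (by omega)).trans_isTheta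
      (isTheta_stieltjesTerm ℓ n).symm)
  refine ((h1.add (isLittleO_stieltjesTerm ℓ (show n < n + 1 by omega))).add
    (isLittleO_stieltjesTerm ℓ (show n < n + 2 by omega))).congr_left fun q => ?_
  rw [sum_booleCoeff_mul (fun k => logPowDeriv ℓ k q)]
  simp_rw [← stieltjesTerm_eq]
  rw [Finset.sum_range_succ _ (n + 2), Finset.sum_range_succ _ (n + 1)]
  push_cast
  ring
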